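/- **Theorem.** Let $\iota : N \to M$ be a homomorphism of (unital, associative) rings; regard $M$ as an $N$-$N$-bimodule via $n\cdot m\cdot n' = \iota(n)\,m\,\iota(n')$. Suppose that $M|N$ has depth two, i.e. for some positive integers $n, m$, the bimodule $M\otimes_N M$ is isomorphic to a direct summand of $\oplus^n M$ as an $N$-$M$-bimodule and to a direct summand of $\oplus^m M$ as an $M$-$N$-bimodule. Put $A = \mathrm{End}({}_NM_N)$ (with composition as product), $R = C_M(N) = \{r\in M : r\iota(n) = \iota(n)r\ \forall n\in N\}$ and $B = (M\otimes_N M)^N = \{b : nb = bn\ \forall n\in N\}$. For $r \in R$ let $\lambda(r), \rho(r)\in A$ be $\lambda(r)(m) = rm$ and $\rho(r)(m) = mr$; $A$ is an $R$-$R$-bimodule by $r\cdot\alpha\cdot r' = \lambda(r)\rho(r')\alpha : m\mapsto r\alpha(m)r'$. Then: 1. There is a right depth two quasibasis: finitely many $c_i = c_i^1\otimes c_i^2\in B$ (summation understood) and $\gamma_i\in A$ with $\sum_i \gamma_i(m)c_i^1\otimes c_i^2 = 1\otimes m$ for all $m \in M$. 2. $A$ is a left bialgebroid $\langle A, R, s,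 t, \Delta, \varepsilon\rangle$ over $R$ with $$s(r) = \lambda(r),\quad t(r) = \rho(r),\quad \Delta(\alpha) = \sum_i \gamma_i\otimes_R c_i^1\,\alpha(c_i^2\,-),\quad \varepsilon(\alpha) = \alpha(1_M),$$ where the formula for $\Delta$ holds for every right depth two quasibasis $(c_i,\gamma_i)$. That is: $s : R\to A$ and $t : R^{op}\to A$ are ring homomorphisms with $s(r)t(r') = t(r')s(r)$; $\Delta : A\to A\otimes_R A$ and $\varepsilon : A\to R$ are $R$-$R$-bimodule maps, where $r\cdot a\cdot r' = s(r)t(r')a$; $(\Delta\otimes \mathrm{id})\Delta = (\mathrm{id}\otimes\Delta)\Delta$; $(\varepsilon\otimes \mathrm{id})\Delta = \mathrm{id} = (\mathrm{id}\otimes\varepsilon)\Delta$; $\Delta(a)(t(r)\otimes 1) = \Delta(a)(1\otimes s(r))$; $\Delta(ab) = \Delta(a)\Delta(b)$; $\Delta(1) = 1\otimes 1$; $\varepsilon(1) = 1$; and $\varepsilon(a\,s(\varepsilon(b))) = \varepsilon(ab) = \varepsilon(a\,t(\varepsilon(b)))$. 3. $M$, with its own multiplication and unit, is a left $A$-module algebroid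 under evaluation $\alpha\triangleright m = \alpha(m)$. That is: with the bimodule structure $r\cdot m\cdot r' = s(r)t(r')\triangleright m$, the multiplication is an associative $R$-$R$-bimodule map $M\otimes_R M\to M$ with unit map $R \to M$, $r\mapsto r\cdot 1_M = 1_M\cdot r$, and it satisfies $a\triangleright(mm') = (a_{(1)}\triangleright m)(a_{(2)}\triangleright m')$ and $a\triangleright 1_M = \varepsilon(a)\cdot 1_M$. 4. If moreover $M_N$ is balanced, i.e. $n\mapsto (m\mapsto m\iota(n))$ is a bijection of $N$ onto the ring of endomorphisms of $M$ as a left $\mathrm{End}(M_N)$-module, then $\iota$ is injective and the invariants $M^A = \{m\in M : \alpha\triangleright m = s(\varepsilon(\alpha))\triangleright m\ \ \forall\alpha\in A\}$ are exactly $\iota(N)$. -/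

import Mathlib

open scoped TensorProduct
open MulOpposite (op)

namespace RingExt

universe u v w

/-! ## Bimodules over noncommutative rings and their tensor products -/

/-- An `S`-`T`-bimodule structure on the abelian group `P`: a left action of `S` and a right action
of `T` (that is, a left action of `Tᵐᵒᵖ`) that commute.  Actions are given as unital ring
homomorphisms to the ring of additive endomorphisms, so that one abelian group can carry several
bimodule structures. -/
structure BimodStr (S T P : Type*) [Ring S] [Ring T] [AddCommGroup P] where
  left : S →+* AddMonoid.End P
  right : Tᵐᵒᵖ →+* AddMonoid.End P
  left_right : ∀ s t p, left s (right t p) = right t (left s p)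

section Bimodules

variable {S T U V S' T' : Type*} [Ring S] [Ring T] [Ring U] [Ring V] [Ring S'] [Ring T']
variable {P Q Z P' Q' : Type*} [AddCommGroup P] [AddCommGroup Q] [AddCommGroup Z]
  [AddCommGroup P'] [AddCommGroup Q']

/-- The ring `R` as an `R`-`R`-bimodule. -/
noncomputable def BimodStr.regular (R : Type*) [Ring R] : BimodStr R R R where
  left := Module.toAddMonoidEnd R R
  right := Module.toAddMonoidEnd Rᵐᵒᵖ R
  left_right s t p := smul_comm s t p

/-- Restriction of scalars on both sides. -/
def BimodStr.restrict (X : BimodStr S T P) (f : S' →+* S) (g : T' →+* T) : BimodStr S' T' P where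
  left := X.left.comp f
  right := X.right.comp g.op
  left_right s t p := X.left_right (f s) (g.op t) p

/-- `f` is a homomorphism of `S`-`T`-bimodules. -/
def IsBimodHom (X : BimodStr S T P) (Y : BimodStr S T Q) (f : P →+ Q) : Prop :=
  (∀ s p, f (X.left s p) = Y.left s (f p)) ∧ ∀ t p, f (X.right t p) = Y.right t (f p)

theorem IsBimodHom.id (X : BimodStr S T P) : IsBimodHom X X (AddMonoidHom.id P) :=
  ⟨fun _ _ => rfl, fun _ _ => rfl⟩

/-- The ring of bimodule endomorphisms, with composition as multiplication. -/
def bimodEnd (X : BimodStr S T P) : Subring (AddMonoid.End P) where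
  carrier := {f | IsBimodHom X X f}
  mul_mem' {f g} hf hg :=
    ⟨fun s p => (congrArg f (hg.1 s p)).trans (hf.1 s (g p)),
      fun t p => (congrArg f (hg.2 t p)).trans (hf.2 t (g p))⟩
  one_mem' := ⟨fun _ _ => rfl, fun _ _ => rfl⟩
  add_mem' hf hg :=
    ⟨fun s p => (congrArg₂ (· + ·) (hf.1 s p) (hg.1 s p)).trans (map_add (X.left s) _ _).symm,
      fun t p => (congrArg₂ (· + ·) (hf.2 t p) (hg.2 t p)).trans (map_add (X.right t) _ _).symm⟩
  zero_mem' := ⟨fun s _ => (map_zero (X.left s)).symm, fun t _ => (map_zero (X.right t)).symm⟩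
  neg_mem' hf :=
    ⟨fun s p => (congrArg (- ·) (hf.1 s p)).trans (map_neg (X.left s) _).symm,
      fun t p => (congrArg (- ·) (hf.2 t p)).trans (map_neg (X.right t) _).symm⟩

/-- The direct sum of two bimodules. -/
def BimodStr.prod (X : BimodStr S T P) (Y : BimodStr S T Q) : BimodStr S T (P × Q) where
  left :=
    { toFun := fun s => (X.left s).prodMap (Y.left s)
      map_one' := by ext x <;> simp <;> rfl
      map_mul' := fun a b => by ext x <;> simp <;> rfl
      map_zero' := by ext x <;> simp <;> rfl
      map_add' := fun a b => by ext x <;> simp <;> rfl }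
  right :=
    { toFun := fun t => (X.right t).prodMap (Y.right t)
      map_one' := by ext x <;> simp <;> rfl
      map_mul' := fun a b => by ext x <;> simp <;> rfl
      map_zero' := by ext x <;> simp <;> rfl
      map_add' := fun a b => by ext x <;> simp <;> rfl }
  left_right s t p := Prod.ext (X.left_right s t p.1) (Y.left_right s t p.2)

/-- The direct sum of `n` copies of a bimodule. -/
def BimodStr.pow (X : BimodStr S T P) (n : ℕ) : BimodStr S T (Fin n → P) where
  left :=
    { toFun := fun s => (X.left s).compLeft (Fin n)
      map_one' := by ext x i; simp; rfl
      map_mul' := fun a b => by ext x i; simp; rfl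
      map_zero' := by ext x i; simp; rfl
      map_add' := fun a b => by ext x i; simp; rfl }
  right :=
    { toFun := fun t => (X.right t).compLeft (Fin n)
      map_one' := by ext x i; simp; rfl
      map_mul' := fun a b => by ext x i; simp; rfl
      map_zero' := by ext x i; simp; rfl
      map_add' := fun a b => by ext x i; simp; rfl }
  left_right s t p := funext fun i => X.left_right s t (p i)

/-- The bimodule `X` is isomorphic to a direct summand of the direct sum of `n` copies of `Y`:
there are a bimodule `Z` and an isomorphism of bimodules `X ⊕ Z ≅ Y ⊕ ⋯ ⊕ Y`. -/
def IsSummandOfPow {Q : Type w} [AddCommGroup Q] (X : BimodStr S T P) (Y : BimodStr S T Q)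
    (n : ℕ) : Prop :=
  ∃ (C : Type w) (_ : AddCommGroup C) (Z : BimodStr S T C) (e : (P × C) ≃+ (Fin n → Q)),
    IsBimodHom (X.prod Z) (Y.pow n) e.toAddMonoidHom

/-- The subgroup of `P ⊗[ℤ] Q` generated by all `p · t ⊗ q - p ⊗ t · q`. -/
def tensorRel (X : BimodStr S T P) (Y : BimodStr T U Q) : AddSubgroup (P ⊗[ℤ] Q) :=
  AddSubgroup.closure
    {z | ∃ (p : P) (t : T) (q : Q), z = X.right (op t) p ⊗ₜ[ℤ] q - p ⊗ₜ[ℤ] Y.left t q}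

/-- The tensor product `P ⊗_T Q` over the (noncommutative) ring `T`. -/
def Tensor (X : BimodStr S T P) (Y : BimodStr T U Q) : Type _ := (P ⊗[ℤ] Q) ⧸ tensorRel X Y

namespace Tensor

noncomputable instance (X : BimodStr S T P) (Y : BimodStr T U Q) : AddCommGroup (Tensor X Y) :=
  inferInstanceAs (AddCommGroup ((P ⊗[ℤ] Q) ⧸ tensorRel X Y))

/-- The pure tensor `p ⊗ q`. -/
def tmul (X : BimodStr S T P) (Y : BimodStr T U Q) (p : P) (q : Q) : Tensor X Y :=
  QuotientAddGroup.mk' (tensorRel X Y) (p ⊗ₜ[ℤ] q)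

variable {X : BimodStr S T P} {Y : BimodStr T U Q}

theorem tmul_add (p : P) (q q' : Q) : tmul X Y p (q + q') = tmul X Y p q + tmul X Y p q' := by
  simp only [tmul, TensorProduct.tmul_add]
  exact map_add (QuotientAddGroup.mk' (tensorRel X Y)) _ _

theorem add_tmul (p p' : P) (q : Q) : tmul X Y (p + p') q = tmul X Y p q + tmul X Y p' q := by
  simp only [tmul, TensorProduct.add_tmul]
  exact map_add (QuotientAddGroup.mk' (tensorRel X Y)) _ _

theorem right_tmul (p : P) (t : T) (q : Q) :
    tmul X Y (X.right (op t) p) q = tmul X Y p (Y.left t q) := by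
  refine (QuotientAddGroup.eq_iff_sub_mem (N := tensorRel X Y)).2 ?_
  exact AddSubgroup.subset_closure ⟨p, t, q, rfl⟩

/-- The biadditive map `(p, q) ↦ p ⊗ q`. -/
noncomputable def mk (X : BimodStr S T P) (Y : BimodStr T U Q) : P →+ Q →+ Tensor X Y :=
  AddMonoidHom.mk' (fun p => AddMonoidHom.mk' (fun q => tmul X Y p q) (tmul_add p))
    (fun p p' => by ext q; exact add_tmul p p' q)

/-- The additive map out of `P ⊗_T Q` given by a biadditive `T`-balanced map. -/
noncomputable def lift {G : Type*} [AddCommGroup G] (f : P →+ Q →+ G)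
    (h : ∀ p t q, f (X.right (op t) p) q = f p (Y.left t q)) : Tensor X Y →+ G :=
  QuotientAddGroup.lift (tensorRel X Y)
    (TensorProduct.liftAddHom f (fun r p q => by simp)) (by
      refine (AddSubgroup.closure_le _).2 ?_
      rintro _ ⟨p, t, q, rfl⟩
      change _ = _
      rw [map_sub, TensorProduct.liftAddHom_tmul, TensorProduct.liftAddHom_tmul, h, sub_self])

@[simp]
theorem lift_tmul {G : Type*} [AddCommGroup G] (f : P →+ Q →+ G)
    (h : ∀ p t q, f (X.right (op t) p) q = f p (Y.left t q)) (p : P) (q : Q) :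
    lift (X := X) (Y := Y) f h (tmul X Y p q) = f p q := rfl

theorem induction_on {C : Tensor X Y → Prop} (z : Tensor X Y)
    (tmul : ∀ p q, C (tmul X Y p q)) (add : ∀ x y, C x → C y → C (x + y)) : C z := by
  obtain ⟨z, rfl⟩ := QuotientAddGroup.mk'_surjective (tensorRel X Y) z
  induction z with
  | zero =>
    have h := tmul 0 0
    rwa [Tensor.tmul, TensorProduct.zero_tmul] at h
  | tmul p q => exact tmul p q
  | add x y hx hy => exact add _ _ hx hy

theorem hom_ext {G : Type*} [AddCommGroup G] {f g : Tensor X Y →+ G}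
    (h : ∀ p q, f (tmul X Y p q) = g (tmul X Y p q)) : f = g := by
  ext z
  induction z using induction_on with
  | tmul p q => exact h p q
  | add x y hx hy => rw [map_add, map_add, hx, hy]

/-- The map `f ⊗ g` for bimodule homomorphisms `f` and `g`. -/
noncomputable def map {X' : BimodStr S T P'} {Y' : BimodStr T U Q'} (f : P →+ P') (g : Q →+ Q')
    (hf : IsBimodHom X X' f) (hg : IsBimodHom Y Y' g) : Tensor X Y →+ Tensor X' Y' :=
  lift ((AddMonoidHom.compHom' g).comp ((mk X' Y').comp f)) (fun p t q => by
    change tmul X' Y' (f _) (g q) = tmul X' Y' (f p) (g _)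
    rw [hf.2, hg.1, right_tmul])

@[simp]
theorem map_tmul {X' : BimodStr S T P'} {Y' : BimodStr T U Q'} (f : P →+ P') (g : Q →+ Q')
    (hf : IsBimodHom X X' f) (hg : IsBimodHom Y Y' g) (p : P) (q : Q) :
    map f g hf hg (tmul X Y p q) = tmul X' Y' (f p) (g q) := rfl

/-- The left action of `s` on `P ⊗_T Q`. -/
noncomputable def leftAct (X : BimodStr S T P) (Y : BimodStr T U Q) (s : S) :
    AddMonoid.End (Tensor X Y) :=
  lift ((mk X Y).comp (X.left s)) (fun p t q => by
    change tmul X Y (X.left s _) q = tmul X Y (X.left s p) _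
    rw [X.left_right, right_tmul])

/-- The right action of `a` on `P ⊗_T Q`. -/
noncomputable def rightAct (X : BimodStr S T P) (Y : BimodStr T U Q) (a : Uᵐᵒᵖ) :
    AddMonoid.End (Tensor X Y) :=
  lift ((AddMonoidHom.compHom' (Y.right a)).comp (mk X Y)) (fun p t q => by
    change tmul X Y _ (Y.right a q) = tmul X Y p (Y.right a _)
    rw [right_tmul, Y.left_right])

/-- The `S`-`U`-bimodule structure on `P ⊗_T Q`: `s · (p ⊗ q) · a = (s · p) ⊗ (q · a)`. -/
noncomputable def bimod (X : BimodStr S T P) (Y : BimodStr T U Q) :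
    BimodStr S U (Tensor X Y) where
  left :=
    { toFun := leftAct X Y
      map_one' := hom_ext fun p q => by
        change tmul X Y (X.left 1 p) q = tmul X Y p q
        rw [map_one]; rfl
      map_mul' := fun a b => hom_ext fun p q => by
        change tmul X Y (X.left (a * b) p) q = tmul X Y (X.left a (X.left b p)) q
        rw [map_mul]; rfl
      map_zero' := hom_ext fun p q => by
        change mk X Y (X.left 0 p) q = 0
        rw [map_zero X.left]
        exact DFunLike.congr_fun (map_zero (mk X Y)) q
      map_add' := fun a b => hom_ext fun p q => by
        change tmul X Y (X.left (a + b) p) q = tmul X Y (X.left a p) q + tmul X Y (X.left b p) q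
        rw [map_add, ← add_tmul]; rfl }
  right :=
    { toFun := rightAct X Y
      map_one' := hom_ext fun p q => by
        change tmul X Y p (Y.right 1 q) = tmul X Y p q
        rw [map_one]; rfl
      map_mul' := fun a b => hom_ext fun p q => by
        change tmul X Y p (Y.right (a * b) q) = tmul X Y p (Y.right a (Y.right b q))
        rw [map_mul]; rfl
      map_zero' := hom_ext fun p q => by
        change mk X Y p (Y.right 0 q) = 0
        rw [map_zero Y.right]
        exact map_zero (mk X Y p)
      map_add' := fun a b => hom_ext fun p q => by
        change tmul X Y p (Y.right (a + b) q) = tmul X Y p (Y.right a q) + tmul X Y p (Y.right b q)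
        rw [map_add, ← tmul_add]; rfl }
  left_right s a z := by
    induction z using induction_on with
    | tmul p q => rfl
    | add x y hx hy => simp only [map_add, hx, hy]

/-- The associativity map `(P ⊗_T Q) ⊗_U Z → P ⊗_T (Q ⊗_U Z)`. -/
noncomputable def assoc (X : BimodStr S T P) (Y : BimodStr T U Q) (W : BimodStr U V Z) :
    Tensor (bimod X Y) W →+ Tensor X (bimod Y W) :=
  lift
    (lift
      (AddMonoidHom.mk' (fun p => (AddMonoidHom.compHom (mk X (bimod Y W) p)).comp (mk Y W))
        (fun p p' => by ext q z; exact add_tmul p p' _))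
      (fun p t q => by ext z; exact right_tmul p t (tmul Y W q z)))
    (fun x a z => by
      induction x using induction_on with
      | tmul p q =>
        change tmul X (bimod Y W) p (tmul Y W (Y.right (op a) q) z) =
          tmul X (bimod Y W) p (tmul Y W q (W.left a z))
        rw [right_tmul]
      | add x y hx hy => simp only [map_add, AddMonoidHom.add_apply, hx, hy])

@[simp]
theorem assoc_tmul (X : BimodStr S T P) (Y : BimodStr T U Q) (W : BimodStr U V Z)
    (p : P) (q : Q) (z : Z) :
    assoc X Y W (tmul (bimod X Y) W (tmul X Y p q) z) =
      tmul X (bimod Y W) p (tmul Y W q z) := rfl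

/-- The canonical map `S ⊗_S P → P`, `s ⊗ p ↦ s · p`. -/
noncomputable def lid (X : BimodStr S T P) : Tensor (BimodStr.regular S) X →+ P :=
  lift (X.left : S →+ AddMonoid.End P) (fun s t p => by
    change X.left (s * t) p = X.left s (X.left t p)
    rw [map_mul]; rfl)

/-- The canonical map `P ⊗_T T → P`, `p ⊗ t ↦ p · t`. -/
noncomputable def rid (X : BimodStr S T P) : Tensor X (BimodStr.regular T) →+ P :=
  lift (AddMonoidHom.flip
      (AddMonoidHom.mk' (fun t : T => (X.right (op t) : P →+ P)) (fun a b => by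
        rw [MulOpposite.op_add, map_add]; rfl)))
    (fun p s t => by
      change X.right (op t) (X.right (op s) p) = X.right (op (s * t)) p
      rw [MulOpposite.op_mul, map_mul]; rfl)

@[simp]
theorem lid_tmul (X : BimodStr S T P) (s : S) (p : P) :
    lid X (tmul (BimodStr.regular S) X s p) = X.left s p := rfl

@[simp]
theorem rid_tmul (X : BimodStr S T P) (p : P) (t : T) :
    rid X (tmul X (BimodStr.regular T) p t) = X.right (op t) p := rfl

end Tensor

end Bimodules

/-! ## Left bialgebroids -/

/-- A source map `s : R → A` and a target map `t : Rᵐᵒᵖ → A` with commuting images. -/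
structure SourceTarget (R A : Type*) [Ring R] [Ring A] where
  s : R →+* A
  t : Rᵐᵒᵖ →+* A
  s_t : ∀ r r', s r * t r' = t r' * s r

namespace SourceTarget

variable {R A : Type*} [Ring R] [Ring A] (K : SourceTarget R A)

/-- The `R`-`R`-bimodule structure `r · a · r' = s(r) t(r') a` on `A`. -/
noncomputable def bimod : BimodStr R R A where
  left := (Module.toAddMonoidEnd A A).comp K.s
  right := (Module.toAddMonoidEnd A A).comp K.t
  left_right r r' a := by
    change K.s r * (K.t r' * a) = K.t r' * (K.s r * a)
    rw [← mul_assoc, K.s_t, mul_assoc]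

/-- `A ⊗_R A`. -/
abbrev Tensor₂ : Type _ := Tensor K.bimod K.bimod

theorem isBimodHom_mulRight (a : A) :
    IsBimodHom K.bimod K.bimod (AddMonoidHom.mulRight a) :=
  ⟨fun r x => mul_assoc (K.s r) x a, fun r x => mul_assoc (K.t r) x a⟩

/-- The map `X ↦ X (a ⊗ b)` on `A ⊗_R A`, that is, `x ⊗ y ↦ x a ⊗ y b`. -/
noncomputable def mulPure (a b : A) : K.Tensor₂ →+ K.Tensor₂ :=
  Tensor.map (AddMonoidHom.mulRight a) (AddMonoidHom.mulRight b)
    (K.isBimodHom_mulRight a) (K.isBimodHom_mulRight b)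

theorem mulPure_mulPure (a b c d : A) (X : K.Tensor₂) :
    K.mulPure c d (K.mulPure a b X) = K.mulPure (a * c) (b * d) X := by
  induction X using Tensor.induction_on with
  | tmul p q =>
    change Tensor.tmul _ _ (p * a * c) (q * b * d) = Tensor.tmul _ _ (p * (a * c)) (q * (b * d))
    rw [mul_assoc, mul_assoc]
  | add x y hx hy => simp only [map_add, hx, hy]

theorem mulPure_add_right (a b b' : A) (X : K.Tensor₂) :
    K.mulPure a (b + b') X = K.mulPure a b X + K.mulPure a b' X := by
  rw [← AddMonoidHom.add_apply]
  refine DFunLike.congr_fun (Tensor.hom_ext fun p q => ?_) X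
  change Tensor.tmul _ _ (p * a) (q * (b + b')) =
    Tensor.tmul _ _ (p * a) (q * b) + Tensor.tmul _ _ (p * a) (q * b')
  rw [mul_add, Tensor.tmul_add]

theorem mulPure_add_left (a a' b : A) (X : K.Tensor₂) :
    K.mulPure (a + a') b X = K.mulPure a b X + K.mulPure a' b X := by
  rw [← AddMonoidHom.add_apply]
  refine DFunLike.congr_fun (Tensor.hom_ext fun p q => ?_) X
  change Tensor.tmul _ _ (p * (a + a')) (q * b) =
    Tensor.tmul _ _ (p * a) (q * b) + Tensor.tmul _ _ (p * a') (q * b)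
  rw [mul_add, Tensor.add_tmul]

/-- `X ∈ A ×_R A`, that is, `X (t(r) ⊗ 1) = X (1 ⊗ s(r))` for all `r`. -/
def IsTakeuchi (X : K.Tensor₂) : Prop :=
  ∀ r : R, K.mulPure (K.t (op r)) 1 X = K.mulPure 1 (K.s r) X

/-- For `X ∈ A ×_R A`, the well-defined map `Y ↦ X Y` on `A ⊗_R A` determined by
`X (a ⊗ b) = ∑ x a ⊗ y b` for `X = ∑ x ⊗ y`. -/
noncomputable def takeuchiMul (X : K.Tensor₂) (hX : K.IsTakeuchi X) : K.Tensor₂ →+ K.Tensor₂ :=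
  Tensor.lift
    (AddMonoidHom.mk'
      (fun a => AddMonoidHom.mk' (fun b => K.mulPure a b X)
        (fun b b' => K.mulPure_add_right a b b' X))
      (fun a a' => by ext b; exact K.mulPure_add_left a a' b X))
    (fun a r b => by
      change K.mulPure (K.t (op r) * a) b X = K.mulPure a (K.s r * b) X
      have h := congrArg (K.mulPure a b) (hX r)
      rwa [mulPure_mulPure, mulPure_mulPure, one_mul, one_mul] at h)

end SourceTarget

/-- A left bialgebroid structure on the ring `A` over the ring `R`. -/
structure LeftBialgebroid (R A : Type*) [Ring R] [Ring A] extends SourceTarget R A where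
  Δ : A →+ toSourceTarget.Tensor₂
  ε : A →+ R
  Δ_hom : IsBimodHom toSourceTarget.bimod
    (Tensor.bimod toSourceTarget.bimod toSourceTarget.bimod) Δ
  ε_hom : IsBimodHom toSourceTarget.bimod (BimodStr.regular R) ε
  /-- `(Δ ⊗ id) ∘ Δ = (id ⊗ Δ) ∘ Δ` -/
  coassoc : ∀ a,
    Tensor.assoc toSourceTarget.bimod toSourceTarget.bimod toSourceTarget.bimod
        (Tensor.map Δ (AddMonoidHom.id A) Δ_hom (IsBimodHom.id _) (Δ a)) =
      Tensor.map (AddMonoidHom.id A) Δ (IsBimodHom.id _) Δ_hom (Δ a)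
  /-- `(ε ⊗ id) ∘ Δ = id` -/
  counit_left : ∀ a,
    Tensor.lid toSourceTarget.bimod
      (Tensor.map ε (AddMonoidHom.id A) ε_hom (IsBimodHom.id _) (Δ a)) = a
  /-- `(id ⊗ ε) ∘ Δ = id` -/
  counit_right : ∀ a,
    Tensor.rid toSourceTarget.bimod
      (Tensor.map (AddMonoidHom.id A) ε (IsBimodHom.id _) ε_hom (Δ a)) = a
  /-- `Δ(a) (t(r) ⊗ 1) = Δ(a) (1 ⊗ s(r))` -/
  Δ_takeuchi : ∀ a, toSourceTarget.IsTakeuchi (Δ a)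
  /-- `Δ(a b) = Δ(a) Δ(b)` -/
  Δ_mul : ∀ a b, Δ (a * b) = toSourceTarget.takeuchiMul (Δ a) (Δ_takeuchi a) (Δ b)
  Δ_one : Δ 1 = Tensor.tmul _ _ 1 1
  ε_one : ε 1 = 1
  ε_mul_s : ∀ a b, ε (a * s (ε b)) = ε (a * b)
  ε_mul_t : ∀ a b, ε (a * t (op (ε b))) = ε (a * b)

/-- The `R`-`R`-bimodule structure `r · m · r' = s(r) t(r') ▷ m` on a left `A`-module. -/
def SourceTarget.actBimod {R A M : Type*} [Ring R] [Ring A] [AddCommGroup M]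
    (K : SourceTarget R A) (act : A →+* AddMonoid.End M) : BimodStr R R M where
  left := act.comp K.s
  right := act.comp K.t
  left_right r r' m := by
    change (act (K.s r) * act (K.t r')) m = (act (K.t r') * act (K.s r)) m
    rw [← map_mul, K.s_t, map_mul]

/-- The orbit map `a ↦ a ▷ m`. -/
def orbit {A M : Type*} [Ring A] [AddCommGroup M] (act : A →+* AddMonoid.End M) (m : M) : A →+ M :=
  AddMonoidHom.mk' (fun a => act a m) (fun a b => by rw [map_add]; rfl)

theorem isBimodHom_orbit {R A M : Type*} [Ring R] [Ring A] [AddCommGroup M]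
    (K : SourceTarget R A) (act : A →+* AddMonoid.End M) (m : M) :
    IsBimodHom K.bimod (K.actBimod act) (orbit act m) := by
  refine ⟨fun r a => ?_, fun r a => ?_⟩
  · change act (K.s r * a) m = act (K.s r) (act a m)
    rw [map_mul]; rfl
  · change act (K.t r * a) m = act (K.t r) (act a m)
    rw [map_mul]; rfl

/-- A left module algebroid structure on the abelian group `M` over the left bialgebroid `H`. -/
structure LeftModuleAlgebroid {R A : Type*} [Ring R] [Ring A] (H : LeftBialgebroid R A)
    (M : Type*) [AddCommGroup M] where
  /-- the left `A`-module structure `a ▷ m` -/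
  act : A →+* AddMonoid.End M
  /-- the multiplication `M ⊗_R M → M` -/
  mul : Tensor (H.actBimod act) (H.actBimod act) →+ M
  mul_hom : IsBimodHom (Tensor.bimod (H.actBimod act) (H.actBimod act)) (H.actBimod act) mul
  mul_assoc : ∀ x y z : M,
    mul (Tensor.tmul _ _ (mul (Tensor.tmul _ _ x y)) z) =
      mul (Tensor.tmul _ _ x (mul (Tensor.tmul _ _ y z)))
  /-- the unit element `1_M`; the unit map is `r ↦ r · 1_M = 1_M · r` -/
  one : M
  unit : ∀ r : R, (H.actBimod act).left r one = (H.actBimod act).right (op r) one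
  one_mul : ∀ m, mul (Tensor.tmul _ _ one m) = m
  mul_one : ∀ m, mul (Tensor.tmul _ _ m one) = m
  /-- `a ▷ (m m') = (a₍₁₎ ▷ m) (a₍₂₎ ▷ m')` -/
  act_mul : ∀ a m m',
    act a (mul (Tensor.tmul _ _ m m')) =
      mul (Tensor.map (orbit act m) (orbit act m') (isBimodHom_orbit H.toSourceTarget act m)
        (isBimodHom_orbit H.toSourceTarget act m') (H.Δ a))
  /-- `a ▷ 1_M = ε(a) · 1_M` -/
  act_one : ∀ a, act a one = (H.actBimod act).left (H.ε a) one

/-- The invariants of a module algebroid. -/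
def LeftModuleAlgebroid.invariants {R A M : Type*} [Ring R] [Ring A] [AddCommGroup M]
    {H : LeftBialgebroid R A} (D : LeftModuleAlgebroid H M) : Set M :=
  {m | ∀ a, D.act a m = D.act (H.s (H.ε a)) m}

/-! ## Ring extensions -/

/-- A right `S`-module `V` is balanced if the canonical map from `S` to the endomorphism ring of
`V` over `End V_S` is bijective.  Both endomorphism rings are centralizers in the ring of additive
endomorphisms. -/
def IsBalanced {S V : Type*} [Ring S] [AddCommGroup V] (ρ : Sᵐᵒᵖ →+* AddMonoid.End V) : Prop :=
  Function.Injective ρ ∧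
    Set.range ρ =
      (Subring.centralizer (Subring.centralizer (Set.range ρ) : Set (AddMonoid.End V)) :
        Set (AddMonoid.End V))

section Extension

variable {N : Type u} {M : Type v} [Ring N] [Ring M] (ι : N →+* M)

/-- `M` as an `N`-`N`-bimodule, `n · m · n' = ι(n) m ι(n')`. -/
noncomputable def bimodNN : BimodStr N N M := (BimodStr.regular M).restrict ι ι

/-- `M` as an `N`-`M`-bimodule. -/
noncomputable def bimodNM : BimodStr N M M := (BimodStr.regular M).restrict ι (RingHom.id M)

/-- `M` as an `M`-`N`-bimodule. -/
noncomputable def bimodMN : BimodStr M N M := (BimodStr.regular M).restrict (RingHom.id M) ι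

/-- The tensor square `M ⊗_N M`. -/
abbrev TensorSq : Type v := Tensor (bimodMN ι) (bimodNM ι)

/-- `M ⊗_N M` as an `M`-`M`-bimodule. -/
noncomputable def bimodSq : BimodStr M M (TensorSq ι) := Tensor.bimod (bimodMN ι) (bimodNM ι)

/-- Left depth two: `M ⊗_N M` is a direct summand of some `Mⁿ` as an `N`-`M`-bimodule. -/
def IsLeftD2 : Prop :=
  ∃ n : ℕ, 0 < n ∧ IsSummandOfPow ((bimodSq ι).restrict ι (RingHom.id M)) (bimodNM ι) n

/-- Right depth two: `M ⊗_N M` is a direct summand of some `Mⁿ` as an `M`-`N`-bimodule. -/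
def IsRightD2 : Prop :=
  ∃ n : ℕ, 0 < n ∧ IsSummandOfPow ((bimodSq ι).restrict (RingHom.id M) ι) (bimodMN ι) n

/-- Depth two: depth two from the left and from the right. -/
def IsD2 : Prop := IsLeftD2 ι ∧ IsRightD2 ι

/-- The ring `A = End_{N-N}(M)`. -/
noncomputable abbrev stepTwoA : Subring (AddMonoid.End M) := bimodEnd (bimodNN ι)

/-- The ring `R = C_M(N)`. -/
abbrev stepOneR : Subring M := Subring.centralizer (Set.range ι)

/-- `B = (M ⊗_N M)^N`: the elements `b` with `n · b = b · n` for all `n ∈ N`. -/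
noncomputable def stepTwoB : AddSubgroup (TensorSq ι) where
  carrier := {b | ∀ n : N, (bimodSq ι).left (ι n) b = (bimodSq ι).right (op (ι n)) b}
  zero_mem' n := by simp
  add_mem' {a b} ha hb n := by simp only [map_add, ha n, hb n]
  neg_mem' {a} ha n := by simp only [map_neg, ha n]

/-- A right depth two quasibasis: `c_i ∈ B` and `γ_i ∈ A` such that
`∑ γ_i(m) c_i¹ ⊗ c_i² = 1 ⊗ m` for all `m`. -/
def IsRightQuasibasis {n : ℕ} (c : Fin n → stepTwoB ι) (γ : Fin n → stepTwoA ι) : Prop :=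
  ∀ m : M, ∑ i, (bimodSq ι).left ((γ i : AddMonoid.End M) m) (c i) = Tensor.tmul _ _ 1 m

/-- The map `M ⊗_N M → M`, `x ⊗ y ↦ x α(y m)`. -/
noncomputable def sandwichEval (α : stepTwoA ι) (m : M) : TensorSq ι →+ M :=
  Tensor.lift
    ((AddMonoidHom.compHom'
      ((α : AddMonoid.End M).comp (AddMonoidHom.mulRight m) : M →+ M)).comp AddMonoidHom.mul)
    (fun x n y => by
      change x * ι n * (α : AddMonoid.End M) (y * m) = x * (α : AddMonoid.End M) (ι n * y * m)
      have h : (α : AddMonoid.End M) (ι n * (y * m)) = ι n * (α : AddMonoid.End M) (y * m) :=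
        α.2.1 n (y * m)
      rw [mul_assoc (ι n) y m, h, mul_assoc])

@[simp]
theorem sandwichEval_tmul (α : stepTwoA ι) (m x y : M) :
    sandwichEval ι α m (Tensor.tmul _ _ x y) = x * (α : AddMonoid.End M) (y * m) := rfl

/-- For `c ∈ B` and `α ∈ A`, the element `c¹ α(c² -)` of `A`. -/
noncomputable def sandwich (c : stepTwoB ι) (α : stepTwoA ι) : stepTwoA ι :=
  ⟨AddMonoidHom.mk' (fun m => sandwichEval ι α m c) (fun m m' => by
      rw [← AddMonoidHom.add_apply]
      refine DFunLike.congr_fun (Tensor.hom_ext fun x y => ?_) _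
      change x * (α : AddMonoid.End M) (y * (m + m')) =
        x * (α : AddMonoid.End M) (y * m) + x * (α : AddMonoid.End M) (y * m')
      rw [mul_add, map_add, mul_add]), by
    refine ⟨fun n m => ?_, fun n m => ?_⟩
    · change sandwichEval ι α (ι n * m) c = ι n * sandwichEval ι α m c
      have h₁ : ∀ z : TensorSq ι, sandwichEval ι α (ι n * m) z =
          sandwichEval ι α m ((bimodSq ι).right (op (ι n)) z) := by
        intro z
        induction z using Tensor.induction_on with
        | tmul x y =>
          change x * (α : AddMonoid.End M) (y * (ι n * m)) =
            x * (α : AddMonoid.End M) (y * ι n * m)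
          rw [mul_assoc]
        | add x y hx hy => simp only [map_add, hx, hy]
      have h₂ : ∀ z : TensorSq ι, sandwichEval ι α m ((bimodSq ι).left (ι n) z) =
          ι n * sandwichEval ι α m z := by
        intro z
        induction z using Tensor.induction_on with
        | tmul x y => exact mul_assoc _ _ _
        | add x y hx hy => simp only [map_add, hx, hy, mul_add]
      rw [h₁, ← c.2 n, h₂]
    · change sandwichEval ι α (m * ι n.unop) c = sandwichEval ι α m c * ι n.unop
      have h₁ : ∀ z : TensorSq ι, sandwichEval ι α (m * ι n.unop) z =
          sandwichEval ι α m z * ι n.unop := by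
        intro z
        induction z using Tensor.induction_on with
        | tmul x y =>
          change x * (α : AddMonoid.End M) (y * (m * ι n.unop)) =
            x * (α : AddMonoid.End M) (y * m) * ι n.unop
          have h : (α : AddMonoid.End M) (y * m * ι n.unop) =
              (α : AddMonoid.End M) (y * m) * ι n.unop := α.2.2 n (y * m)
          rw [← mul_assoc y, h, mul_assoc]
        | add x y hx hy => simp only [map_add, hx, hy, add_mul]
      exact h₁ _⟩

@[simp]
theorem sandwich_apply (c : stepTwoB ι) (α : stepTwoA ι) (m : M) :
    (sandwich ι c α : AddMonoid.End M) m = sandwichEval ι α m c := rfl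

end Extension

end RingExt

/-! Right depth two factors the identity of `M ⊗_N M` through a power of `M`; values at `1` of the
maps in this factorization form a quasibasis, and applying `x ⊗ y ↦ x α(y m)` to its defining
identity gives `α(xy) = ∑ γ_i(x) c_i¹ α(c_i² y)` (`sum_mul_sandwich`). So `Δ(α)` satisfies `α₍₁₎(x)
α₍₂₎(y) = α(xy)`.

This property determines `Δ(α)`, because the maps `p ⊗ q ↦ p(x) q(y)` separate the points of `A ⊗_R
A`, and their threefold analogues those of `A ⊗_R A ⊗_R A` (`eq_zero_of_pairing`). Every coproduct
axiom is therefore checked on values in `M`: coassociativity becomes associativity of `M`, the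
counit laws become its unit laws, and multiplicativity becomes composition of maps. Independence of
the quasibasis is the same uniqueness.

If `m` is invariant, the formula for `α(xy)` shows that every `α ∈ A` commutes with right
multiplication by `m`. Left depth two expresses each `f ∈ End(M_N)` as `∑ u_i β_i(-)` with `u_i ∈ M`
and `β_i ∈ A`, so `f` commutes with it too, and balance puts `m` in `ι(N)`. -/

namespace RingExt

universe u v w

/-! ### Direct summands of powers and tensor products over a noncommutative ring. -/

section Bimodules

variable {S T U : Type*} [Ring S] [Ring T] [Ring U]
variable {P Q : Type*} [AddCommGroup P] [AddCommGroup Q]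

/-- A direct summand of `Yⁿ` admits a finite family of maps to and from `Y` composing to the
identity. -/
theorem IsSummandOfPow.exists_factorization {Q : Type w} [AddCommGroup Q] {X : BimodStr S T P}
    {Y : BimodStr S T Q} {n : ℕ} (h : IsSummandOfPow X Y n) :
    ∃ (f : Fin n → P →+ Q) (g : Fin n → Q →+ P), (∀ i, IsBimodHom X Y (f i)) ∧
      (∀ i, IsBimodHom Y X (g i)) ∧ ∀ p, ∑ i, g i (f i p) = p := by
  obtain ⟨C, _, Z, e, he⟩ := h
  -- Only `e` is assumed to be a bimodule map; its inverse must be one as well, since the maps `g i`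
  -- are built from `e.symm`.
  have hl : ∀ s q, e.symm ((Y.pow n).left s q) = (X.prod Z).left s (e.symm q) := fun s q => by
    rw [AddEquiv.symm_apply_eq]
    have := he.1 s (e.symm q)
    simpa using this.symm
  have hr : ∀ t q, e.symm ((Y.pow n).right t q) = (X.prod Z).right t (e.symm q) := fun t q => by
    rw [AddEquiv.symm_apply_eq]
    have := he.2 t (e.symm q)
    simpa using this.symm
  refine ⟨fun i => (Pi.evalAddMonoidHom _ i).comp (e.toAddMonoidHom.comp (AddMonoidHom.inl P C)),
    fun i => (AddMonoidHom.fst P C).comp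
      (e.symm.toAddMonoidHom.comp (AddMonoidHom.single (fun _ => Q) i)), ?_, ?_, ?_⟩
  · refine fun i => ⟨fun s p => ?_, fun t p => ?_⟩
    · have := congrFun (he.1 s (p, 0)) i
      change e (X.left s p, Z.left s 0) i = Y.left s (e (p, 0) i) at this
      rwa [map_zero] at this
    · have := congrFun (he.2 t (p, 0)) i
      change e (X.right t p, Z.right t 0) i = Y.right t (e (p, 0) i) at this
      rwa [map_zero] at this
  · refine fun i => ⟨fun s q => ?_, fun t q => ?_⟩
    · have := congrArg Prod.fst (hl s (Pi.single i q))
      have h' : (Y.pow n).left s (Pi.single i q) = Pi.single i (Y.left s q) := by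
        funext j
        exact Pi.apply_single (fun _ => Y.left s) (fun _ => map_zero _) i q j
      rw [h'] at this
      exact this
    · have := congrArg Prod.fst (hr t (Pi.single i q))
      have h' : (Y.pow n).right t (Pi.single i q) = Pi.single i (Y.right t q) := by
        funext j
        exact Pi.apply_single (fun _ => Y.right t) (fun _ => map_zero _) i q j
      rw [h'] at this
      exact this
  · intro p
    change ∑ i, (AddMonoidHom.fst P C) (e.symm (Pi.single i (e (p, 0) i))) = p
    rw [← map_sum, ← map_sum, Finset.univ_sum_single, e.symm_apply_apply]
    rfl

namespace Tensor

variable (X : BimodStr S T P) (Y : BimodStr T U Q)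

theorem sum_tmul {κ : Type*} (s : Finset κ) (p : κ → P) (q : Q) :
    tmul X Y (∑ k ∈ s, p k) q = ∑ k ∈ s, tmul X Y (p k) q :=
  map_sum ((mk X Y).flip q) p s

theorem tmul_zero (p : P) : tmul X Y p 0 = 0 := map_zero (mk X Y p)

variable {X Y}

theorem exists_sum_tmul (z : Tensor X Y) :
    ∃ (κ : Type) (_ : Fintype κ) (p : κ → P) (q : κ → Q), z = ∑ k, tmul X Y (p k) (q k) := by
  induction z using induction_on with
  | tmul p q => exact ⟨Unit, inferInstance, fun _ => p, fun _ => q, by simp⟩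
  | add x y hx hy =>
    obtain ⟨κ, _, p, q, rfl⟩ := hx
    obtain ⟨κ', _, p', q', rfl⟩ := hy
    exact ⟨κ ⊕ κ', inferInstance, Sum.elim p p', Sum.elim q q', by simp⟩

end Tensor

end Bimodules

/-! ### Source, target and evaluation action of `A`. -/

section Extension

variable {N : Type u} {M : Type v} [Ring N] [Ring M] (ι : N →+* M)

theorem stepTwoA_map_left_mul (α : stepTwoA ι) (n : N) (m : M) :
    (α : AddMonoid.End M) (ι n * m) = ι n * (α : AddMonoid.End M) m := α.2.1 n m

theorem stepTwoA_map_mul_right (α : stepTwoA ι) (m : M) (n : N) :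
    (α : AddMonoid.End M) (m * ι n) = (α : AddMonoid.End M) m * ι n := α.2.2 (op n) m

theorem stepTwoA_ext {α β : stepTwoA ι}
    (h : ∀ m, (α : AddMonoid.End M) m = (β : AddMonoid.End M) m) : α = β :=
  Subtype.ext (AddMonoidHom.ext h)

theorem map_mul_stepOneR (r : stepOneR ι) (n : N) : ι n * (r : M) = r * ι n :=
  r.2 (ι n) ⟨n, rfl⟩

/-- `r ↦ λ(r)`. -/
noncomputable def lambdaHom : stepOneR ι →+* stepTwoA ι where
  toFun r := ⟨AddMonoidHom.mulLeft (r : M), fun n m => by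
      change (r : M) * (ι n * m) = ι n * (r * m)
      rw [← mul_assoc, ← mul_assoc, map_mul_stepOneR],
    fun n m => (mul_assoc (r : M) m (ι n.unop)).symm⟩
  map_one' := stepTwoA_ext ι fun m => one_mul m
  map_mul' r r' := stepTwoA_ext ι fun m => mul_assoc (r : M) r' m
  map_zero' := stepTwoA_ext ι fun m => zero_mul m
  map_add' r r' := stepTwoA_ext ι fun m => add_mul (r : M) r' m

/-- `r ↦ ρ(r)`. -/
noncomputable def rhoHom : (stepOneR ι)ᵐᵒᵖ →+* stepTwoA ι where
  toFun r := ⟨AddMonoidHom.mulRight (r.unop : M), fun n m => mul_assoc (ι n) m (r.unop : M),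
    fun n m => by
      change m * ι n.unop * (r.unop : M) = m * r.unop * ι n.unop
      rw [mul_assoc, mul_assoc, map_mul_stepOneR]⟩
  map_one' := stepTwoA_ext ι fun m => mul_one m
  map_mul' r r' := stepTwoA_ext ι fun m => (mul_assoc m (r'.unop : M) r.unop).symm
  map_zero' := stepTwoA_ext ι fun m => mul_zero m
  map_add' r r' := stepTwoA_ext ι fun m => mul_add m (r.unop : M) r'.unop

/-- The source and target maps `λ` and `ρ` of `A` over `R`. -/
noncomputable def endSourceTarget : SourceTarget (stepOneR ι) (stepTwoA ι) where
  s := lambdaHom ι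
  t := rhoHom ι
  s_t r r' := stepTwoA_ext ι fun m => (mul_assoc (r : M) m (r'.unop : M)).symm

/-- The evaluation action of `A` on `M`. -/
noncomputable def evalAct : stepTwoA ι →+* AddMonoid.End M := (stepTwoA ι).subtype

/-- The multiplication `M ⊗_R M → M`. -/
noncomputable def mulTensor :
    Tensor ((endSourceTarget ι).actBimod (evalAct ι)) ((endSourceTarget ι).actBimod (evalAct ι)) →+
      M :=
  Tensor.lift AddMonoidHom.mul (fun p r q => mul_assoc p (r : M) q)

theorem isBimodHom_mulTensor :
    IsBimodHom (Tensor.bimod ((endSourceTarget ι).actBimod (evalAct ι))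
      ((endSourceTarget ι).actBimod (evalAct ι))) ((endSourceTarget ι).actBimod (evalAct ι))
      (mulTensor ι) := by
  refine ⟨fun r z => ?_, fun r z => ?_⟩
  · induction z using Tensor.induction_on with
    | tmul x y => exact mul_assoc (r : M) x y
    | add z z' hz hz' => simp only [map_add, hz, hz']
  · induction z using Tensor.induction_on with
    | tmul x y => exact (mul_assoc x y (r.unop : M)).symm
    | add z z' hz hz' => simp only [map_add, hz, hz']

/-! ### Evaluating tensors over `R` in `M`. -/

section Pairing

variable {U Q : Type*} [Ring U] [AddCommGroup Q] {Y : BimodStr (stepOneR ι) U Q}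

/-- The map `A ⊗_R Q → M`, `α ⊗ q ↦ α(x) g(q)`, for a left `R`-linear map `g`. -/
noncomputable def pairing (x : M) (g : Q →+ M)
    (hg : ∀ (r : stepOneR ι) q, g (Y.left r q) = r * g q) :
    Tensor (endSourceTarget ι).bimod Y →+ M :=
  Tensor.lift ((AddMonoidHom.compHom' g).comp (AddMonoidHom.mul.comp (orbit (evalAct ι) x)))
    (fun α r q => by
      change (α : AddMonoid.End M) x * r * g q = (α : AddMonoid.End M) x * g (Y.left r q)
      rw [hg, mul_assoc])

/-- Left `R`-linearity is what allows a pairing to serve as the map `g` of another pairing, so that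
evaluations of longer tensors are built by iteration. -/
theorem pairing_left (x : M) (g : Q →+ M) (hg : ∀ (r : stepOneR ι) q, g (Y.left r q) = r * g q)
    (r : stepOneR ι) (z : Tensor (endSourceTarget ι).bimod Y) :
    pairing ι x g hg ((Tensor.bimod _ Y).left r z) = r * pairing ι x g hg z := by
  induction z using Tensor.induction_on with
  | tmul α q => exact mul_assoc (r : M) ((α : AddMonoid.End M) x) (g q)
  | add z z' hz hz' => simp only [map_add, hz, hz', mul_add]

end Pairing

/-- `α ⊗ β ↦ α(x) β(y)`. -/
noncomputable def evalPair (x y : M) : (endSourceTarget ι).Tensor₂ →+ M :=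
  pairing ι x (orbit (evalAct ι) y) (fun _ _ => rfl)

/-- `α ⊗ β ⊗ γ ↦ α(x) β(y) γ(z)`. -/
noncomputable def evalTriple (x y z : M) :
    Tensor (endSourceTarget ι).bimod
      (Tensor.bimod (endSourceTarget ι).bimod (endSourceTarget ι).bimod) →+ M :=
  pairing ι x (evalPair ι y z) (pairing_left ι y _ _)

theorem evalTriple_tmul (x y z : M) (α : stepTwoA ι) (w : (endSourceTarget ι).Tensor₂) :
    evalTriple ι x y z (Tensor.tmul _ _ α w) = (α : AddMonoid.End M) x * evalPair ι y z w := rfl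

theorem evalPair_right (x y : M) (r : (stepOneR ι)ᵐᵒᵖ) (z : (endSourceTarget ι).Tensor₂) :
    evalPair ι x y ((Tensor.bimod _ _).right r z) = evalPair ι x y z * (r.unop : M) := by
  induction z using Tensor.induction_on with
  | tmul α β =>
    exact (mul_assoc ((α : AddMonoid.End M) x) ((β : AddMonoid.End M) y) (r.unop : M)).symm
  | add z z' hz hz' => simp only [map_add, hz, hz', add_mul]

/-- Right multiplication in `A` is precomposition, so it only moves the evaluation points. -/
theorem evalPair_mulPure (x y : M) (α β : stepTwoA ι) (z : (endSourceTarget ι).Tensor₂) :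
    evalPair ι x y ((endSourceTarget ι).mulPure α β z) =
      evalPair ι ((α : AddMonoid.End M) x) ((β : AddMonoid.End M) y) z := by
  induction z using Tensor.induction_on with
  | tmul p q => rfl
  | add z z' hz hz' => simp only [map_add, hz, hz']

/-- With this identification, the module algebroid axiom for products is exactly the
characterization of `Δ`. -/
theorem mulTensor_map_orbit (x y : M) (z : (endSourceTarget ι).Tensor₂) :
    mulTensor ι (Tensor.map (orbit (evalAct ι) x) (orbit (evalAct ι) y)
      (isBimodHom_orbit _ _ x) (isBimodHom_orbit _ _ y) z) = evalPair ι x y z := by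
  induction z using Tensor.induction_on with
  | tmul p q => rfl
  | add z z' hz hz' => simp only [map_add, hz, hz']

/-- The counit `α ↦ α(1)`. -/
noncomputable def counit : stepTwoA ι →+ stepOneR ι :=
  AddMonoidHom.mk' (fun α => ⟨(α : AddMonoid.End M) 1, by
      rintro _ ⟨n, rfl⟩
      rw [← stepTwoA_map_left_mul, ← stepTwoA_map_mul_right, mul_one, one_mul]⟩)
    (fun _ _ => rfl)

@[simp]
theorem coe_counit (α : stepTwoA ι) : (counit ι α : M) = (α : AddMonoid.End M) 1 := rfl

theorem sandwichEval_add (α β : stepTwoA ι) (m : M) (z : TensorSq ι) :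
    sandwichEval ι (α + β) m z = sandwichEval ι α m z + sandwichEval ι β m z := by
  rw [← AddMonoidHom.add_apply]
  refine DFunLike.congr_fun (Tensor.hom_ext fun x y => ?_) z
  exact mul_add x ((α : AddMonoid.End M) (y * m)) ((β : AddMonoid.End M) (y * m))

theorem sandwichEval_left (α : stepTwoA ι) (m x : M) (z : TensorSq ι) :
    sandwichEval ι α m ((bimodSq ι).left x z) = x * sandwichEval ι α m z := by
  induction z using Tensor.induction_on with
  | tmul p q => exact mul_assoc x p ((α : AddMonoid.End M) (q * m))
  | add z z' hz hz' => simp only [map_add, hz, hz', mul_add]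

/-- Supplies the `R`-balancedness that makes `coefficient` well defined on `A ⊗_R Q`. -/
theorem sandwichEval_rho (α : stepTwoA ι) (r : stepOneR ι) (m : M) (z : TensorSq ι) :
    sandwichEval ι (rhoHom ι (op r) * α) m z = sandwichEval ι α m z * r := by
  induction z using Tensor.induction_on with
  | tmul p q => exact (mul_assoc p ((α : AddMonoid.End M) (q * m)) (r : M)).symm
  | add z z' hz hz' => simp only [map_add, hz, hz', add_mul]

/-- The map `α ↦ c¹ α(c² -)`. -/
noncomputable def sandwichHom (c : stepTwoB ι) : stepTwoA ι →+ stepTwoA ι :=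
  AddMonoidHom.mk' (sandwich ι c) (fun α β => stepTwoA_ext ι fun m => sandwichEval_add ι α β m c)

/-! ### Expansion along a quasibasis and separation of points. -/

section Coefficient

variable {U Q : Type*} [Ring U] [AddCommGroup Q] {Y : BimodStr (stepOneR ι) U Q}

/-- The map `A ⊗_R Q → Q`, `α ⊗ q ↦ c¹ α(c²) · q`. -/
noncomputable def coefficient (Y : BimodStr (stepOneR ι) U Q) (c : stepTwoB ι) :
    Tensor (endSourceTarget ι).bimod Y →+ Q :=
  Tensor.lift ((Y.left : stepOneR ι →+ AddMonoid.End Q).comp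
      ((counit ι).comp (sandwichHom ι c)))
    (fun α r q => by
      have h : counit ι (sandwichHom ι c (rhoHom ι (op r) * α)) =
          counit ι (sandwichHom ι c α) * r := Subtype.ext (sandwichEval_rho ι α r 1 c)
      change Y.left (counit ι (sandwichHom ι c (rhoHom ι (op r) * α))) q =
        Y.left (counit ι (sandwichHom ι c α)) (Y.left r q)
      rw [h, map_mul]
      rfl)

theorem coefficient_tmul (c : stepTwoB ι) (α : stepTwoA ι) (q : Q) :
    coefficient ι Y c (Tensor.tmul _ _ α q) = Y.left (counit ι (sandwich ι c α)) q := rfl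

variable {ι} {n : ℕ} {c : Fin n → stepTwoB ι} {γ : Fin n → stepTwoA ι}

/-- Apply the left `M`-linear map `u ⊗ v ↦ u α(v y)` to the quasibasis identity at `x`; the
right-hand side `1 ⊗ x` goes to `α(xy)`. -/
theorem IsRightQuasibasis.sum_mul_sandwich (h : IsRightQuasibasis ι c γ) (α : stepTwoA ι)
    (x y : M) :
    ∑ i, (γ i : AddMonoid.End M) x * (sandwich ι (c i) α : AddMonoid.End M) y =
      (α : AddMonoid.End M) (x * y) := by
  have := congrArg (sandwichEval ι α y) (h x)
  simpa only [map_sum, sandwichEval_left, sandwichEval_tmul, one_mul, sandwich_apply] using this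

/-- The `γ_i` act as a dual basis of `A` as a right `R`-module: `α = ∑ γ_i · c_i¹ α(c_i²)`, by
`sum_mul_sandwich` at `y = 1`. On pure tensors the coefficients in `R` are moved across the tensor
sign. -/
theorem IsRightQuasibasis.sum_tmul_coefficient (h : IsRightQuasibasis ι c γ)
    (z : Tensor (endSourceTarget ι).bimod Y) :
    ∑ i, Tensor.tmul _ _ (γ i) (coefficient ι Y (c i) z) = z := by
  induction z using Tensor.induction_on with
  | tmul α q =>
    simp only [coefficient_tmul, ← Tensor.right_tmul]
    rw [← Tensor.sum_tmul]
    congr 1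
    refine stepTwoA_ext ι fun m => ?_
    rw [← mul_one m, ← h.sum_mul_sandwich α m 1, AddSubmonoidClass.coe_finsetSum, mul_one]
    exact AddMonoidHom.finsetSum_apply _ _ m
  | add z z' hz hz' =>
    simp only [map_add, Tensor.tmul_add, Finset.sum_add_distrib, hz, hz']

/-- The pairings `α ⊗ q ↦ α(x) g(q)` separate the points of `A ⊗_R Q` if the maps `g` separate the
points of `Q`. -/
theorem IsRightQuasibasis.eq_zero_of_pairing (h : IsRightQuasibasis ι c γ) {J : Type*}
    (g : J → Q →+ M) (hg : ∀ j (r : stepOneR ι) q, g j (Y.left r q) = r * g j q)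
    (hsep : ∀ q, (∀ j, g j q = 0) → q = 0) (z : Tensor (endSourceTarget ι).bimod Y)
    (hz : ∀ x j, pairing ι x (g j) (hg j) z = 0) : z = 0 := by
  rw [← h.sum_tmul_coefficient z]
  refine Finset.sum_eq_zero fun i _ => ?_
  -- By the expansion, `z` vanishes once all its coefficients in `Q` do, and these are tested by the
  -- maps `g j`.
  suffices coefficient ι Y (c i) z = 0 by rw [this, Tensor.tmul_zero]
  refine hsep _ fun j => ?_
  obtain ⟨κ, _, a, b, hc⟩ := Tensor.exists_sum_tmul (c i : TensorSq ι)
  -- With `c_i = ∑ a_k ⊗ b_k`, the value of `g j` on the coefficient of `α ⊗ q` is `∑ a_k α(b_k)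
  -- g_j(q)`, a left combination of the pairings at the points `b_k`.
  have key : (g j).comp (coefficient ι Y (c i)) =
      ∑ k, (AddMonoidHom.mulLeft (a k)).comp (pairing ι (b k) (g j) (hg j)) := by
    refine Tensor.hom_ext fun α q => ?_
    rw [AddMonoidHom.finsetSum_apply, AddMonoidHom.comp_apply, coefficient_tmul, hg, coe_counit,
      sandwich_apply, hc, map_sum, Finset.sum_mul]
    refine Finset.sum_congr rfl fun k _ => ?_
    rw [sandwichEval_tmul, mul_one]
    exact mul_assoc _ _ _
  have := DFunLike.congr_fun key z
  rw [AddMonoidHom.comp_apply] at this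
  rw [this, AddMonoidHom.finsetSum_apply]
  refine Finset.sum_eq_zero fun k _ => ?_
  rw [AddMonoidHom.comp_apply, hz, map_zero]

end Coefficient

variable {ι} {n : ℕ} {c : Fin n → stepTwoB ι} {γ : Fin n → stepTwoA ι}

/-- Elements of `A` are maps on `M`, so evaluations at points separate `A`; the criterion then
applies with `Q = A`. -/
theorem IsRightQuasibasis.eq_zero_of_evalPair (h : IsRightQuasibasis ι c γ)
    (z : (endSourceTarget ι).Tensor₂) (hz : ∀ x y, evalPair ι x y z = 0) : z = 0 :=
  h.eq_zero_of_pairing (fun y => orbit (evalAct ι) y) (fun _ _ _ => rfl)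
    (fun _ hα => stepTwoA_ext ι fun m => hα m) z hz

theorem IsRightQuasibasis.evalPair_ext (h : IsRightQuasibasis ι c γ)
    {z z' : (endSourceTarget ι).Tensor₂} (hz : ∀ x y, evalPair ι x y z = evalPair ι x y z') :
    z = z' :=
  sub_eq_zero.1 (h.eq_zero_of_evalPair _ fun x y => by rw [map_sub, hz, sub_self])

/-- The criterion applied once more, with `Q = A ⊗_R A` separated by the maps `evalPair`. -/
theorem IsRightQuasibasis.evalTriple_ext (h : IsRightQuasibasis ι c γ)
    {w w' : Tensor (endSourceTarget ι).bimod
      (Tensor.bimod (endSourceTarget ι).bimod (endSourceTarget ι).bimod)}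
    (hw : ∀ x y z, evalTriple ι x y z w = evalTriple ι x y z w') : w = w' := by
  refine sub_eq_zero.1 (h.eq_zero_of_pairing (fun j : M × M => evalPair ι j.1 j.2)
    (fun j => pairing_left ι j.1 _ _)
    (fun q hq => h.eq_zero_of_evalPair q fun x y => hq (x, y)) _ fun x j => ?_)
  rw [map_sub]
  exact sub_eq_zero.2 (hw x j.1 j.2)

/-! ### The coproduct, the bialgebroid and the module algebroid. -/

variable (ι) in
/-- The coproduct `α ↦ ∑ γ_i ⊗ c_i¹ α(c_i² -)`. -/
noncomputable def comul (c : Fin n → stepTwoB ι) (γ : Fin n → stepTwoA ι) :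
    stepTwoA ι →+ (endSourceTarget ι).Tensor₂ :=
  ∑ i, (Tensor.mk _ _ (γ i)).comp (sandwichHom ι (c i))

theorem comul_apply (α : stepTwoA ι) :
    comul ι c γ α = ∑ i, Tensor.tmul _ _ (γ i) (sandwich ι (c i) α) :=
  AddMonoidHom.finsetSum_apply _ _ α

theorem IsRightQuasibasis.evalPair_sum (h : IsRightQuasibasis ι c γ) (α : stepTwoA ι) (x y : M) :
    evalPair ι x y (∑ i, Tensor.tmul _ _ (γ i) (sandwich ι (c i) α)) =
      (α : AddMonoid.End M) (x * y) := by
  rw [map_sum, ← h.sum_mul_sandwich]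
  rfl

theorem IsRightQuasibasis.evalPair_comul (h : IsRightQuasibasis ι c γ) (α : stepTwoA ι)
    (x y : M) : evalPair ι x y (comul ι c γ α) = (α : AddMonoid.End M) (x * y) := by
  rw [comul_apply, h.evalPair_sum]

theorem IsRightQuasibasis.isBimodHom_comul (h : IsRightQuasibasis ι c γ) :
    IsBimodHom (endSourceTarget ι).bimod
      (Tensor.bimod (endSourceTarget ι).bimod (endSourceTarget ι).bimod) (comul ι c γ) := by
  refine ⟨fun r α => h.evalPair_ext fun x y => ?_, fun r α => h.evalPair_ext fun x y => ?_⟩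
  · have h' := pairing_left ι x (orbit (evalAct ι) y) (fun _ _ => rfl) r (comul ι c γ α)
    refine Eq.trans ?_ h'.symm
    rw [h.evalPair_comul]
    exact congrArg ((r : M) * ·) (h.evalPair_comul α x y).symm
  · rw [evalPair_right, h.evalPair_comul, h.evalPair_comul]
    rfl

variable (ι) in
theorem isBimodHom_counit :
    IsBimodHom (endSourceTarget ι).bimod (BimodStr.regular (stepOneR ι)) (counit ι) :=
  ⟨fun _ _ => rfl, fun _ _ => rfl⟩

/-- After evaluation the condition reads `α((xr)y) = α(x(ry))`. -/
theorem IsRightQuasibasis.isTakeuchi_comul (h : IsRightQuasibasis ι c γ) (α : stepTwoA ι) :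
    (endSourceTarget ι).IsTakeuchi (comul ι c γ α) := fun r => h.evalPair_ext fun x y => by
  rw [evalPair_mulPure, evalPair_mulPure, h.evalPair_comul, h.evalPair_comul]
  exact congrArg (α : AddMonoid.End M) (mul_assoc x (r : M) y)

/-- For `X = ∑ u ⊗ v` with the evaluations of `Δ(α)`, the product `X (p ⊗ q)` evaluates to `∑
u(p(x)) v(q(y)) = α(p(x) q(y))`: left multiplication by `X` is application of `α` to the value. -/
theorem evalPair_takeuchiMul (X : (endSourceTarget ι).Tensor₂)
    (hX : (endSourceTarget ι).IsTakeuchi X) (α : stepTwoA ι)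
    (h : ∀ x y, evalPair ι x y X = (α : AddMonoid.End M) (x * y))
    (x y : M) (z : (endSourceTarget ι).Tensor₂) :
    evalPair ι x y ((endSourceTarget ι).takeuchiMul X hX z) =
      (α : AddMonoid.End M) (evalPair ι x y z) := by
  induction z using Tensor.induction_on with
  | tmul p q => exact (evalPair_mulPure ι x y p q X).trans (h _ _)
  | add z z' hz hz' => simp only [map_add, hz, hz']

variable (ι) in
theorem evalTriple_assoc (x y z : M) (w : (endSourceTarget ι).Tensor₂) (α : stepTwoA ι) :
    evalTriple ι x y z (Tensor.assoc _ _ _ (Tensor.tmul _ _ w α)) =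
      evalPair ι x y w * (α : AddMonoid.End M) z := by
  induction w using Tensor.induction_on with
  | tmul p q => exact (mul_assoc _ _ _).symm
  | add w w' hw hw' => simp only [Tensor.add_tmul, map_add, hw, hw', add_mul]

/-- Splitting the first factor merges the points `x` and `y`. Together with the mirror statement for
the second factor, this turns coassociativity into `(xy)z = x(yz)`. -/
theorem IsRightQuasibasis.evalTriple_assoc_map_comul (h : IsRightQuasibasis ι c γ) (x y z : M)
    (w : (endSourceTarget ι).Tensor₂) :
    evalTriple ι x y z (Tensor.assoc _ _ _ (Tensor.map (comul ι c γ) (AddMonoidHom.id _)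
      h.isBimodHom_comul (IsBimodHom.id _) w)) = evalPair ι (x * y) z w := by
  induction w using Tensor.induction_on with
  | tmul p q =>
    rw [Tensor.map_tmul, evalTriple_assoc, h.evalPair_comul]
    rfl
  | add w w' hw hw' => simp only [map_add, hw, hw']

theorem IsRightQuasibasis.evalTriple_map_comul (h : IsRightQuasibasis ι c γ) (x y z : M)
    (w : (endSourceTarget ι).Tensor₂) :
    evalTriple ι x y z (Tensor.map (AddMonoidHom.id _) (comul ι c γ) (IsBimodHom.id _)
      h.isBimodHom_comul w) = evalPair ι x (y * z) w := by
  induction w using Tensor.induction_on with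
  | tmul p q =>
    rw [Tensor.map_tmul, evalTriple_tmul, h.evalPair_comul]
    rfl
  | add w w' hw hw' => simp only [map_add, hw, hw']

variable (ι) in
-- The counit is evaluation at `1`, so it sets the first evaluation point to `1`.
theorem lid_map_counit_apply (m : M) (w : (endSourceTarget ι).Tensor₂) :
    (Tensor.lid (endSourceTarget ι).bimod (Tensor.map (counit ι) (AddMonoidHom.id _)
      (isBimodHom_counit ι) (IsBimodHom.id _) w) : AddMonoid.End M) m = evalPair ι 1 m w := by
  induction w using Tensor.induction_on with
  | tmul p q => rfl
  | add w w' hw hw' =>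
    rw [map_add, map_add, map_add, ← hw, ← hw']
    rfl

variable (ι) in
theorem rid_map_counit_apply (m : M) (w : (endSourceTarget ι).Tensor₂) :
    (Tensor.rid (endSourceTarget ι).bimod (Tensor.map (AddMonoidHom.id _) (counit ι)
      (IsBimodHom.id _) (isBimodHom_counit ι) w) : AddMonoid.End M) m = evalPair ι m 1 w := by
  induction w using Tensor.induction_on with
  | tmul p q => rfl
  | add w w' hw hw' =>
    rw [map_add, map_add, map_add, ← hw, ← hw']
    rfl

/-- The left bialgebroid `A` over `R` given by a right depth two quasibasis. -/
noncomputable def IsRightQuasibasis.bialgebroid (h : IsRightQuasibasis ι c γ) :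
    LeftBialgebroid (stepOneR ι) (stepTwoA ι) where
  toSourceTarget := endSourceTarget ι
  Δ := comul ι c γ
  ε := counit ι
  Δ_hom := h.isBimodHom_comul
  ε_hom := isBimodHom_counit ι
  coassoc α := h.evalTriple_ext fun x y z => by
    rw [h.evalTriple_assoc_map_comul, h.evalTriple_map_comul, h.evalPair_comul, h.evalPair_comul,
      mul_assoc]
  counit_left α := stepTwoA_ext ι fun m => by
    rw [lid_map_counit_apply, h.evalPair_comul, one_mul]
  counit_right α := stepTwoA_ext ι fun m => by
    rw [rid_map_counit_apply, h.evalPair_comul, mul_one]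
  Δ_takeuchi := h.isTakeuchi_comul
  Δ_mul α β := h.evalPair_ext fun x y => by
    rw [evalPair_takeuchiMul _ _ α (h.evalPair_comul α), h.evalPair_comul, h.evalPair_comul]
    rfl
  Δ_one := h.evalPair_ext fun x y => h.evalPair_comul 1 x y
  ε_one := rfl
  ε_mul_s α β := Subtype.ext
    (congrArg (α : AddMonoid.End M) (mul_one ((β : AddMonoid.End M) 1)))
  ε_mul_t α β := Subtype.ext
    (congrArg (α : AddMonoid.End M) (one_mul ((β : AddMonoid.End M) 1)))

/-- `M` as a module algebroid over `A` under evaluation. -/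
noncomputable def IsRightQuasibasis.moduleAlgebroid (h : IsRightQuasibasis ι c γ) :
    LeftModuleAlgebroid h.bialgebroid M where
  act := evalAct ι
  mul := mulTensor ι
  mul_hom := isBimodHom_mulTensor ι
  mul_assoc := mul_assoc
  one := 1
  unit r := (mul_one (r : M)).trans (one_mul (r : M)).symm
  one_mul := one_mul
  mul_one := mul_one
  act_mul α m m' := (h.evalPair_comul α m m').symm.trans (mulTensor_map_orbit ι m m' _).symm
  act_one α := (mul_one ((α : AddMonoid.End M) 1)).symm

/-! ### Quasibases from the depth two conditions. -/

variable (ι)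

/-- Take `c_i = g_i(1)` and `γ_i(m) = f_i(1 ⊗ m)`. Then `c_i ∈ B` because `ι(n) · 1 = 1 · ι(n)`, and
left linearity of `g_i` gives `γ_i(m) c_i = g_i(f_i(1 ⊗ m))`. -/
theorem IsRightD2.exists_quasibasis (h : IsRightD2 ι) :
    ∃ (n : ℕ) (c : Fin n → stepTwoB ι) (γ : Fin n → stepTwoA ι), IsRightQuasibasis ι c γ := by
  obtain ⟨n, -, h⟩ := h
  obtain ⟨f, g, hf, hg, hfg⟩ := h.exists_factorization
  refine ⟨n, fun i => ⟨g i 1, fun n => ?_⟩, fun i =>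
    ⟨(f i).comp (Tensor.mk (bimodMN ι) (bimodNM ι) 1), fun n m => ?_, fun n m => ?_⟩, fun m => ?_⟩
  · refine ((hg i).1 (ι n) 1).symm.trans (Eq.trans ?_ ((hg i).2 (op n) 1))
    exact congrArg (g i) ((mul_one (ι n)).trans (one_mul (ι n)).symm)
  · refine Eq.trans (congrArg (f i) ?_) ((hf i).1 (ι n) (Tensor.tmul _ _ 1 m))
    -- Left `N`-linearity of `γ_i` is not immediate, since the scalar sits in the second factor: `1
    -- ⊗ nm = n ⊗ m = n · (1 ⊗ m)`.
    refine (Tensor.right_tmul (X := bimodMN ι) (Y := bimodNM ι) 1 n m).symm.trans ?_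
    exact congrArg (fun x => Tensor.tmul _ _ x m) ((one_mul (ι n)).trans (mul_one (ι n)).symm)
  · exact (hf i).2 n (Tensor.tmul _ _ 1 m)
  · refine Eq.trans (Finset.sum_congr rfl fun i _ => ?_) (hfg (Tensor.tmul _ _ 1 m))
    refine ((hg i).1 _ 1).symm.trans (congrArg (g i) ?_)
    exact mul_one (f i (Tensor.tmul _ _ 1 m))

/-- The mirror construction, `b_i = g_i(1)` and `β_i(m) = f_i(m ⊗ 1)`. Membership of `b_i` in `B` is
not recorded, as the invariants argument only needs the identity. -/
theorem IsLeftD2.exists_quasibasis (h : IsLeftD2 ι) :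
    ∃ (n : ℕ) (b : Fin n → TensorSq ι) (β : Fin n → stepTwoA ι),
      ∀ m : M, ∑ i, (bimodSq ι).right (op ((β i : AddMonoid.End M) m)) (b i) =
        Tensor.tmul _ _ m 1 := by
  obtain ⟨n, -, h⟩ := h
  obtain ⟨f, g, hf, hg, hfg⟩ := h.exists_factorization
  refine ⟨n, fun i => g i 1, fun i =>
    ⟨(f i).comp ((Tensor.mk (bimodMN ι) (bimodNM ι)).flip 1), fun n m => ?_, fun n m => ?_⟩,
    fun m => ?_⟩
  · exact (hf i).1 n (Tensor.tmul _ _ m 1)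
  · refine Eq.trans (congrArg (f i) ?_) ((hf i).2 (op (ι n.unop)) (Tensor.tmul _ _ m 1))
    refine (Tensor.right_tmul (X := bimodMN ι) (Y := bimodNM ι) m n.unop 1).trans ?_
    exact congrArg (Tensor.tmul _ _ m) ((mul_one (ι n.unop)).trans (one_mul (ι n.unop)).symm)
  · refine Eq.trans (Finset.sum_congr rfl fun i _ => ?_) (hfg (Tensor.tmul _ _ m 1))
    refine ((hg i).2 (op _) 1).symm.trans (congrArg (g i) ?_)
    exact one_mul (f i (Tensor.tmul _ _ m 1))

/-! ### Invariants and balanced modules. -/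

/-- The map `x ⊗ y ↦ f(x) y` for a right `N`-linear endomorphism `f`. -/
noncomputable def contractRight (f : AddMonoid.End M) (hf : ∀ m n, f (m * ι n) = f m * ι n) :
    TensorSq ι →+ M :=
  Tensor.lift (AddMonoidHom.mul.comp f) (fun p n q => by
    change f (p * ι n) * q = f p * (ι n * q)
    rw [hf, mul_assoc])

theorem contractRight_right (f : AddMonoid.End M) (hf : ∀ m n, f (m * ι n) = f m * ι n)
    (m : M) (z : TensorSq ι) :
    contractRight ι f hf ((bimodSq ι).right (op m) z) = contractRight ι f hf z * m := by
  induction z using Tensor.induction_on with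
  | tmul x y => exact (mul_assoc (f x) y m).symm
  | add z z' hz hz' => simp only [map_add, hz, hz', add_mul]

variable {ι}

/-- If `m` is invariant under `A`, then `A` commutes with right multiplication by `m`. -/
theorem IsRightQuasibasis.map_mul_of_invariant (h : IsRightQuasibasis ι c γ) {m : M}
    (hm : ∀ α : stepTwoA ι, (α : AddMonoid.End M) m = (α : AddMonoid.End M) 1 * m)
    (β : stepTwoA ι) (x : M) :
    (β : AddMonoid.End M) (x * m) = (β : AddMonoid.End M) x * m := by
  -- Writing `x` as `x * 1` expands both sides along the quasibasis, at `y = m` and `y = 1`; the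
  -- terms agree by invariance applied to `c_i¹ β(c_i² -)`.
  conv_rhs => rw [← mul_one x]
  rw [← h.sum_mul_sandwich, ← h.sum_mul_sandwich, Finset.sum_mul]
  refine Finset.sum_congr rfl fun i _ => ?_
  rw [hm (sandwich ι (c i) β), mul_assoc]

/-- For a left depth two extension every right `N`-linear endomorphism of `M` commutes with right
multiplications by invariants of `A`. -/
theorem IsLeftD2.map_mul_of_invariant (hl : IsLeftD2 ι) (h : IsRightQuasibasis ι c γ) {m : M}
    (hm : ∀ α : stepTwoA ι, (α : AddMonoid.End M) m = (α : AddMonoid.End M) 1 * m)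
    (f : AddMonoid.End M) (hf : ∀ m n, f (m * ι n) = f m * ι n) (x : M) :
    f (x * m) = f x * m := by
  obtain ⟨k, b, β, hb⟩ := hl.exists_quasibasis
  -- Contracting the left quasibasis identity with `f` gives `f(y) = ∑ f(b_i¹) b_i² β_i(y)`, so the
  -- commutation need only be known for the `β_i`.
  have key : ∀ y, f y = ∑ i, contractRight ι f hf (b i) * (β i : AddMonoid.End M) y := fun y => by
    have := congrArg (contractRight ι f hf) (hb y)
    rw [map_sum] at this
    simp only [contractRight_right] at this
    exact (mul_one (f y)).symm.trans this.symm
  rw [key, key x, Finset.sum_mul]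
  refine Finset.sum_congr rfl fun i _ => ?_
  rw [h.map_mul_of_invariant hm, mul_assoc]

theorem IsLeftD2.invariants_eq_range (hl : IsLeftD2 ι) (h : IsRightQuasibasis ι c γ)
    (hbal : IsBalanced (bimodNN ι).right) :
    h.moduleAlgebroid.invariants = (ι.range : Set M) := by
  ext m
  constructor
  · intro hm
    have hmem : (AddMonoidHom.mulRight m : AddMonoid.End M) ∈ Set.range (bimodNN ι).right := by
      -- Balance makes the image of `N` a double centralizer, so it suffices that right
      -- multiplication by `m` commutes with every `f ∈ End(M_N)`.
      rw [hbal.2]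
      intro f hf
      refine AddMonoidHom.ext fun x => ?_
      refine hl.map_mul_of_invariant h hm f (fun y n => ?_) x
      exact (DFunLike.congr_fun (hf _ ⟨op n, rfl⟩) y).symm
    obtain ⟨n, hn⟩ := hmem
    refine ⟨n.unop, ?_⟩
    -- Two right multiplications that agree at `1` have the same multiplier.
    have := DFunLike.congr_fun hn (1 : M)
    exact (one_mul (ι n.unop)).symm.trans (this.trans (one_mul m))
  · rintro ⟨n, rfl⟩ α
    have := stepTwoA_map_mul_right ι α 1 n
    rwa [one_mul] at this

theorem IsBalanced.injective_of_right (hbal : IsBalanced (bimodNN ι).right) :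
    Function.Injective ι := fun a b hab => by
  refine MulOpposite.op_injective (hbal.1 (AddMonoidHom.ext fun m => ?_))
  exact congrArg (m * ·) hab

end Extension

end RingExt

theorem mainTheorem2 {N M : Type*} [Ring N] [Ring M] (ι : N →+* M) (hD2 : RingExt.IsD2 ι) :
    (∃ (n : ℕ) (c : Fin n → RingExt.stepTwoB ι) (γ : Fin n → RingExt.stepTwoA ι),
      RingExt.IsRightQuasibasis ι c γ) ∧
    ∃ H : RingExt.LeftBialgebroid (RingExt.stepOneR ι) (RingExt.stepTwoA ι),
      (∀ (r : RingExt.stepOneR ι) (m : M), (H.s r : AddMonoid.End M) m = r * m) ∧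
      (∀ (r : RingExt.stepOneR ι) (m : M),
        (H.t (MulOpposite.op r) : AddMonoid.End M) m = m * r) ∧
      (∀ (r r' : RingExt.stepOneR ι) (α : RingExt.stepTwoA ι) (m : M),
        (H.bimod.left r (H.bimod.right (MulOpposite.op r') α) : AddMonoid.End M) m =
          r * (α : AddMonoid.End M) m * r') ∧
      (∀ (n : ℕ) (c : Fin n → RingExt.stepTwoB ι) (γ : Fin n → RingExt.stepTwoA ι),
        RingExt.IsRightQuasibasis ι c γ →
        ∀ α : RingExt.stepTwoA ι,
          H.Δ α = ∑ i, RingExt.Tensor.tmul _ _ (γ i) (RingExt.sandwich ι (c i) α)) ∧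
      (∀ α : RingExt.stepTwoA ι, (H.ε α : M) = (α : AddMonoid.End M) 1) ∧
      ∃ D : RingExt.LeftModuleAlgebroid H M,
        (∀ (α : RingExt.stepTwoA ι) (m : M), D.act α m = (α : AddMonoid.End M) m) ∧
        (∀ m m' : M, D.mul (RingExt.Tensor.tmul _ _ m m') = m * m') ∧
        D.one = 1 ∧
        (RingExt.IsBalanced (RingExt.bimodNN ι).right →
          Function.Injective ι ∧ D.invariants = (ι.range : Set M)) := by
  refine ⟨hD2.2.exists_quasibasis, ?_⟩
  obtain ⟨n, c, γ, h⟩ := hD2.2.exists_quasibasis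
  refine ⟨h.bialgebroid, fun _ _ => rfl, fun _ _ => rfl,
    fun r r' α m => (mul_assoc (r : M) ((α : AddMonoid.End M) m) (r' : M)).symm,
    fun k c' γ' h' α => h.evalPair_ext fun x y => ?_, fun _ => rfl, h.moduleAlgebroid,
    fun _ _ => rfl, fun _ _ => rfl, rfl,
    fun hbal => ⟨hbal.injective_of_right, hD2.1.invariants_eq_range h hbal⟩⟩
  -- `H` is built from one chosen quasibasis; the formula of any other has the same evaluations
  -- `α(xy)`, hence gives the same tensor.
  exact (h.evalPair_comul α x y).trans (h'.evalPair_sum α x y).symm
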